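/- Let $n\ge 0$ be an integer, let $0<\xi_1<\dots<\xi_n<1$ and $g_1,\dots,g_n>0$, and let $g=\sum_{i=1}^n g_i\,\delta_{\xi_i}$. Consider the cubic string equation $$-\phi_{\xi\xi\xi}=z\,g\,\phi\quad\text{on }(0,1),$$ for functions $\phi$ continuous on $[0,1]$, in the sense of distributions, with spectral parameter $z\in\mathbb C$. (Derivatives at $0$ and $1$ are one-sided.) The boundary value problem of Type $a\in\{0,1,2\}$ is this equation with $\phi(0)=\phi_\xi(0)=0$ and, at the other end, $\phi(1)=0$ (Type 0), $\phi_\xi(1)=0$ (Type 1), $\phi_{\xi\xi}(1)=0$ (Type 2); the spectrum of Type $a$ is the set of $z\in\mathbb C$ for which it has a solution that is not identically zero. Write $(f,h)_g=\int_0^1 fh\,dg=\sum_{i=1}^n g_i f(\xi_i)h(\xi_i)$. For every $z\in\mathbb C$ the initial value problem $\phi(0)=\phi_\xi(0)=0$, $\phi_{\xi\xi}(0)=1$ for the equation has a unique solution $\phi(\cdot\,;z)$ on $[0,1]$, and the following hold. 1. For each $a=0,1,2$ the spectrum of Type $a$ consists of exactly $n$ points $z_{a,1}<\dots<z_{a,n}$,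 all real and positive, and it is simple: the eigenspace of $z_{a,j}$ is spanned by $\phi_{a,j}:=\phi(\cdot\,;z_{a,j})$, and $z_{a,j}$ is a simple zero of $z\mapsto\partial_\xi^a\phi(1;z)$. 2. The spectra interlace: $z_{2,j}<z_{1,j}<z_{0,j}$ for $1\le j\le n$, and $z_{0,j}<z_{2,j+1}$ for $1\le j<n$. 3. For each $a=0,1,2$ the eigenfunctions $\phi_{a,1},\dots,\phi_{a,n}$ are linearly independent, both as functions on $[0,1]$ and as elements of $L^2_g[0,1]$. 4. For all $1\le i,j\le n$, $$(\phi_{0,i},\phi_{0,j})_g=\frac{\phi_{0,i,\xi}(1)\,\phi_{0,j,\xi}(1)}{z_{0,i}+z_{0,j}},\qquad (\phi_{0,i},\phi_{1,j})_g=-\frac{\phi_{0,i,\xi\xi}(1)\,\phi_{1,j}(1)}{z_{0,i}+z_{1,j}},$$ $$(\phi_{1,i},\phi_{2,j})_g=-\frac{\phi_{1,i,\xi\xi}(1)\,\phi_{2,j}(1)}{z_{1,i}+z_{2,j}},\qquad (\phi_{2,i},\phi_{2,j})_g=\frac{\phi_{2,i,\xi}(1)\,\phi_{2,j,\xi}(1)}{z_{2,i}+z_{2,j}}.$$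 -/

import Mathlib

open MeasureTheory Set

/-- A discrete cubic string on `[0,1]`: `n` point masses `g i > 0` placed at positions
`0 < x 0 < x 1 < ⋯ < x (n-1) < 1`. -/
structure DiscreteCubicString (n : ℕ) where
  /-- the masses -/
  g : Fin n → ℝ
  /-- their positions -/
  x : Fin n → ℝ
  g_pos : ∀ i, 0 < g i
  x_strictMono : StrictMono x
  x_mem : ∀ i, x i ∈ Ioo (0 : ℝ) 1

namespace DiscreteCubicString

variable {n : ℕ} (S : DiscreteCubicString n)

/-- The mass distribution `∑ i, g i • δ_{x i}` as a measure on the line (it is carried by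
the open interval `(0,1)`). -/
noncomputable def mass : Measure ℝ :=
  ∑ i, ENNReal.ofReal (S.g i) • Measure.dirac (S.x i)

/-- The bilinear form `(f, h)_g = ∫ f h dg`. -/
noncomputable def form (f h : ℝ → ℂ) : ℂ := ∫ ξ, f ξ * h ξ ∂S.mass

/-- `f` is continuous on `[0,1]` and satisfies the cubic string equation `-f''' = z g f` on
`(0,1)` in the sense of distributions: three integrations by parts turn
`-⟨f''', ψ⟩` into `∫ f ψ'''`. Only the values of `f` on `[0,1]` matter. -/
def SolvesEquation (z : ℂ) (f : ℝ → ℂ) : Prop :=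
  ContinuousOn f (Icc 0 1) ∧
    ∀ ψ : ℝ → ℝ, ContDiff ℝ (⊤ : ℕ∞) ψ → HasCompactSupport ψ → tsupport ψ ⊆ Ioo 0 1 →
      ∫ ξ in (0 : ℝ)..1, f ξ * ((iteratedDeriv 3 ψ ξ : ℝ) : ℂ) = z * ∫ ξ, f ξ * ((ψ ξ : ℝ) : ℂ) ∂S.mass

end DiscreteCubicString

/-- The derivative of order `k` of a function on the string `[0,1]`, one-sided at the two
end points. -/
noncomputable def stringDeriv (k : ℕ) (f : ℝ → ℂ) (ξ : ℝ) : ℂ :=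
  iteratedDerivWithin k f (Icc (0 : ℝ) 1) ξ

namespace DiscreteCubicString

variable {n : ℕ} (S : DiscreteCubicString n)

/-- The initial value problem: `f` solves the cubic string equation with spectral parameter
`z`, and `f(0) = f'(0) = 0`, `f''(0) = 1`. -/
def SolvesIVP (z : ℂ) (f : ℝ → ℂ) : Prop :=
  S.SolvesEquation z f ∧
    stringDeriv 0 f 0 = 0 ∧ stringDeriv 1 f 0 = 0 ∧ stringDeriv 2 f 0 = 1

/-- `f` is an eigenfunction, for the spectral parameter `z`, of the boundary value problem of
type `a`: a solution of the cubic string equation, not identically zero on `[0,1]`, such that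
`f(0) = f'(0) = 0`, and `f(1) = 0` (`a = 0`), `f'(1) = 0` (`a = 1`), `f''(1) = 0` (`a = 2`). -/
def IsEigenfunction (a : Fin 3) (z : ℂ) (f : ℝ → ℂ) : Prop :=
  S.SolvesEquation z f ∧
    stringDeriv 0 f 0 = 0 ∧ stringDeriv 1 f 0 = 0 ∧ stringDeriv (a : ℕ) f 1 = 0 ∧
    ∃ ξ ∈ Icc (0 : ℝ) 1, f ξ ≠ 0

/-- The spectrum of the boundary value problem of type `a`: its complex eigenvalues. -/
def spectrum (a : Fin 3) : Set ℂ := {z | ∃ f, S.IsEigenfunction a z f}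

end DiscreteCubicString

section Interlacing

open Polynomial

/-- `p` has degree `n`, is positive at the left of its zeros, and these are `ζ 0, …, ζ (n-1)`. -/
def HasRootSeq (p : ℝ[X]) (n : ℕ) (ζ : ℕ → ℝ) : Prop :=
  ∃ c : ℝ, 0 < c ∧ p = C c * ∏ j ∈ Finset.range n, (C (ζ j) - X)

theorem HasRootSeq.eval_eq_zero {p : ℝ[X]} {n : ℕ} {ζ : ℕ → ℝ} (h : HasRootSeq p n ζ) {j : ℕ}
    (hj : j < n) : p.eval (ζ j) = 0 := by
  obtain ⟨c, -, rfl⟩ := h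
  rw [eval_mul, eval_prod, Finset.prod_eq_zero (Finset.mem_range.2 hj) (by simp), mul_zero]

theorem HasRootSeq.sign_eval {p : ℝ[X]} {n : ℕ} {ζ : ℕ → ℝ} (h : HasRootSeq p n ζ) {k : ℕ}
    (hk : k ≤ n) {w : ℝ} (hlt : ∀ j < k, ζ j < w) (hgt : ∀ j, k ≤ j → j < n → w < ζ j) :
    0 < (-1) ^ k * p.eval w := by
  obtain ⟨c, hc, rfl⟩ := h
  have h1 : (-1 : ℝ) ^ k * ∏ j ∈ Finset.range k, (ζ j - w) = ∏ j ∈ Finset.range k, (w - ζ j) := by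
    rw [← Finset.card_range k, ← Finset.prod_const, Finset.card_range, ← Finset.prod_mul_distrib]
    exact Finset.prod_congr rfl fun j _ => by ring
  have h2 : 0 < ∏ j ∈ Finset.range k, (w - ζ j) :=
    Finset.prod_pos fun j hj => sub_pos.2 (hlt j (Finset.mem_range.1 hj))
  have h3 : 0 < ∏ j ∈ Finset.Ico k n, (ζ j - w) :=
    Finset.prod_pos fun j hj => sub_pos.2
      (hgt j (Finset.mem_Ico.1 hj).1 (Finset.mem_Ico.1 hj).2)
  have h4 : (-1 : ℝ) ^ k * (C c * ∏ j ∈ Finset.range n, (C (ζ j) - X)).eval w =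
      c * (∏ j ∈ Finset.range k, (w - ζ j)) * ∏ j ∈ Finset.Ico k n, (ζ j - w) := by
    rw [← h1, eval_mul, eval_prod, eval_C, ← Finset.prod_range_mul_prod_Ico _ hk]
    simp only [eval_sub, eval_C, eval_X]
    ring
  rw [h4]
  positivity

theorem HasRootSeq.eval_zero_pos {p : ℝ[X]} {n : ℕ} {ζ : ℕ → ℝ} (h : HasRootSeq p n ζ)
    (hζ : ∀ j < n, 0 < ζ j) : 0 < p.eval 0 := by
  simpa using h.sign_eval (k := 0) (Nat.zero_le n) (by simp) (fun j _ hj => hζ j hj)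

theorem natDegree_prod_C_sub_X (n : ℕ) (ζ : ℕ → ℝ) :
    (∏ j ∈ Finset.range n, (C (ζ j) - X)).natDegree = n := by
  have h : ∀ a : ℝ, (C a - X).natDegree = 1 := fun a => by
    rw [← neg_sub, natDegree_neg, natDegree_X_sub_C]
  have h0 : ∀ a : ℝ, (C a - X) ≠ 0 := fun a h' => by simpa [h'] using h a
  rw [natDegree_prod _ _ fun j _ => h0 _]
  simp [h]

theorem leadingCoeff_prod_C_sub_X (n : ℕ) (ζ : ℕ → ℝ) :
    (∏ j ∈ Finset.range n, (C (ζ j) - X)).leadingCoeff = (-1) ^ n := by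
  have h : ∀ a : ℝ, (C a - X).leadingCoeff = -1 := fun a => by
    rw [← neg_sub, leadingCoeff_neg, leadingCoeff_X_sub_C]
  rw [leadingCoeff_prod]
  simp [h]

theorem HasRootSeq.natDegree_eq {p : ℝ[X]} {n : ℕ} {ζ : ℕ → ℝ} (h : HasRootSeq p n ζ) :
    p.natDegree = n := by
  obtain ⟨c, hc, rfl⟩ := h
  rw [natDegree_C_mul hc.ne', natDegree_prod_C_sub_X]

theorem HasRootSeq.coeff_pos {p : ℝ[X]} {n : ℕ} {ζ : ℕ → ℝ} (h : HasRootSeq p n ζ) :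
    0 < (-1) ^ n * p.coeff n := by
  have hd := h.natDegree_eq
  obtain ⟨c, hc, rfl⟩ := h
  have hl : (C c * ∏ j ∈ Finset.range n, (C (ζ j) - X)).coeff n =
      (C c * ∏ j ∈ Finset.range n, (C (ζ j) - X)).leadingCoeff := by rw [leadingCoeff, hd]
  rw [hl, leadingCoeff_mul, leadingCoeff_C, leadingCoeff_prod_C_sub_X,
    mul_left_comm, ← mul_pow]
  simpa using hc

theorem exists_hasRootSeq {p : ℝ[X]} {m : ℕ} (hdeg : p.natDegree ≤ m) (h0 : 0 < p.eval 0)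
    {a b : ℕ → ℝ} (ha : ∀ j < m, 0 ≤ a j) (hab : ∀ j < m, a j < b j)
    (hba : ∀ j k, j < k → k < m → b j ≤ a k)
    (hsa : ∀ j < m, 0 < (-1) ^ j * p.eval (a j))
    (hsb : ∀ j < m, 0 < (-1) ^ (j + 1) * p.eval (b j)) :
    ∃ ζ, HasRootSeq p m ζ ∧ ∀ j < m, a j < ζ j ∧ ζ j < b j := by
  have key : ∀ j, ∃ z, j < m → (a j < z ∧ z < b j) ∧ p.eval z = 0 := by
    intro j
    by_cases hj : j < m
    · have hc : ContinuousOn (fun t => (-1) ^ j * p.eval t) (Icc (a j) (b j)) := by fun_prop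
      have hmem : (0 : ℝ) ∈ Ioo ((-1) ^ j * p.eval (b j)) ((-1) ^ j * p.eval (a j)) := by
        refine ⟨?_, hsa j hj⟩
        have := hsb j hj
        rw [pow_succ] at this
        linarith
      obtain ⟨z, hz, hz0⟩ := intermediate_value_Ioo' (hab j hj).le hc hmem
      refine ⟨z, fun _ => ⟨hz, ?_⟩⟩
      simpa using hz0
    · exact ⟨0, fun h => absurd h hj⟩
  choose ζ hζ using key
  have hlt : ∀ j k, j < k → k < m → ζ j < ζ k := fun j k hjk hk =>
    ((hζ j (hjk.trans hk)).1.2.trans_le (hba j k hjk hk)).trans (hζ k hk).1.1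
  have hdvd : ∏ j ∈ Finset.range m, (C (ζ j) - X) ∣ p := by
    refine Finset.prod_dvd_of_coprime ?_ ?_
    · intro j hj k hk hjk
      have hne : ζ j ≠ ζ k := by
        rcases lt_or_gt_of_ne hjk with h | h
        · exact (hlt j k h (by simpa using hk)).ne
        · exact (hlt k j h (by simpa using hj)).ne'
      have := isCoprime_X_sub_C_of_isUnit_sub (sub_ne_zero.2 hne).isUnit
      simpa using this.neg_neg
    · intro j hj
      rw [← neg_sub, neg_dvd, dvd_iff_isRoot]
      exact (hζ j (by simpa using hj)).2
  obtain ⟨q, hq⟩ := hdvd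
  have hp0 : p ≠ 0 := fun h => by simp [h] at h0
  have hq0 : q ≠ 0 := fun h => hp0 (by rw [hq, h, mul_zero])
  have hP0 : ∏ j ∈ Finset.range m, (C (ζ j) - X) ≠ 0 := fun h => hp0 (by rw [hq, h, zero_mul])
  have hqd : q.natDegree = 0 := by
    have := natDegree_mul hP0 hq0
    rw [← hq, natDegree_prod_C_sub_X] at this
    omega
  rw [eq_C_of_natDegree_eq_zero hqd] at hq
  refine ⟨ζ, ⟨q.coeff 0, ?_, by rw [mul_comm]; exact hq⟩, fun j hj => (hζ j hj).1⟩
  rw [hq, eval_mul, eval_prod, eval_C] at h0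
  refine pos_of_mul_pos_right h0 (Finset.prod_nonneg fun j hj => ?_)
  have hj := Finset.mem_range.1 hj
  simpa using ((ha j hj).trans_lt (hζ j hj).1.1).le

theorem exists_large_sign {p : ℝ[X]} {m : ℕ} (hm : 0 < m) (hdeg : p.natDegree ≤ m)
    (hc : 0 < (-1) ^ m * p.coeff m) (B : ℝ) : ∃ M, B < M ∧ 0 < (-1) ^ m * p.eval M := by
  have hd : (C ((-1) ^ m) * p).natDegree = m := by
    rw [natDegree_C_mul (by simp)]
    refine le_antisymm hdeg (le_natDegree_of_ne_zero fun h => ?_)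
    simp [h] at hc
  have hl : 0 ≤ (C ((-1) ^ m) * p).leadingCoeff := by
    rw [leadingCoeff, hd, coeff_C_mul]
    exact hc.le
  have ht := tendsto_atTop_of_leadingCoeff_nonneg _
    (natDegree_pos_iff_degree_pos.1 (hd.symm ▸ hm)) hl
  obtain ⟨M, h1, h2⟩ := ((Filter.eventually_gt_atTop B).and (ht.eventually_gt_atTop 0)).exists
  exact ⟨M, h1, by simpa using h2⟩

/-- Three polynomials of degree `n` with positive interlacing zeros
`ζ₂ 0 < ζ₁ 0 < ζ₀ 0 < ζ₂ 1 < ζ₁ 1 < ⋯`. -/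
structure Interlaced (n : ℕ) (p : Fin 3 → ℝ[X]) (ζ : Fin 3 → ℕ → ℝ) : Prop where
  roots : ∀ a, HasRootSeq (p a) n (ζ a)
  pos : ∀ j < n, 0 < ζ 2 j
  lt₂₁ : ∀ j < n, ζ 2 j < ζ 1 j
  lt₁₀ : ∀ j < n, ζ 1 j < ζ 0 j
  lt₀₂ : ∀ j k, j < k → k < n → ζ 0 j < ζ 2 k

theorem Interlaced.root_pos {n : ℕ} {p : Fin 3 → ℝ[X]} {ζ : Fin 3 → ℕ → ℝ}
    (h : Interlaced n p ζ) (a : Fin 3) {j : ℕ} (hj : j < n) : 0 < ζ a j := by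
  have := h.pos j hj
  have := h.lt₂₁ j hj
  have := h.lt₁₀ j hj
  fin_cases a <;> simp <;> linarith

theorem Interlaced.strictMono {n : ℕ} {p : Fin 3 → ℝ[X]} {ζ : Fin 3 → ℕ → ℝ}
    (h : Interlaced n p ζ) (a : Fin 3) {j k : ℕ} (hjk : j < k) (hk : k < n) : ζ a j < ζ a k := by
  have := h.lt₀₂ j k hjk hk
  have := h.lt₂₁ j (hjk.trans hk)
  have := h.lt₁₀ j (hjk.trans hk)
  have := h.lt₂₁ k hk
  have := h.lt₁₀ k hk
  fin_cases a <;> simp <;> linarith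

theorem neg_one_pow_eval_add_pos {p q : ℝ[X]} {k : ℕ} {w c : ℝ} (hc : 0 < c)
    (hp : 0 ≤ (-1) ^ k * p.eval w) (hq : 0 < (-1) ^ k * q.eval w) :
    0 < (-1) ^ k * (p + C c * q).eval w := by
  have : (-1) ^ k * (p + C c * q).eval w = (-1) ^ k * p.eval w + c * ((-1) ^ k * q.eval w) := by
    simp; ring
  rw [this]
  positivity

/-- Interlacing is preserved when a mass `g` is passed, and the string is continued by a
massless interval of length `ℓ`. -/
theorem Interlaced.step {n : ℕ} {p : Fin 3 → ℝ[X]} {ζ : Fin 3 → ℕ → ℝ} (h : Interlaced n p ζ)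
    {g ℓ : ℝ} (hg : 0 < g) (hℓ : 0 < ℓ) {q : Fin 3 → ℝ[X]}
    (h₂ : q 2 = p 2 - C g * X * p 0) (h₁ : q 1 = p 1 + C ℓ * q 2)
    (h₀ : q 0 = p 0 + C ℓ * p 1 + C (ℓ ^ 2 / 2) * q 2) :
    ∃ ζ', Interlaced (n + 1) q ζ' := by
  obtain ⟨hr, hpos, h21, h10, h02⟩ := id h
  have hd : ∀ a, (p a).natDegree ≤ n := fun a => (hr a).natDegree_eq.le
  have hcoeff : ∀ a, (p a).coeff (n + 1) = 0 := fun a =>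
    coeff_eq_zero_of_natDegree_lt (Nat.lt_succ_of_le (hd a))
  have hz0 : ∀ a, ∀ j < n, 0 < ζ a j := fun a j hj => h.root_pos a hj
  have hlt : ∀ a, ∀ j k, j < k → k < n → ζ a j < ζ a k := fun a j k hjk hk =>
    h.strictMono a hjk hk
  have hle : ∀ a, ∀ j k, j ≤ k → k < n → ζ a j ≤ ζ a k := fun a j k hjk hk =>
    hjk.eq_or_lt.elim (fun h => h ▸ le_rfl) fun h => (hlt a j k h hk).le
  have hd2 : (q 2).natDegree ≤ n + 1 := by
    rw [h₂]
    refine (natDegree_sub_le _ _).trans (max_le ((hd 2).trans n.le_succ) ?_)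
    rw [mul_assoc]
    refine (natDegree_C_mul_le _ _).trans (natDegree_mul_le.trans ?_)
    have := hd 0
    rw [natDegree_X]
    omega
  have hc2 : 0 < (-1) ^ (n + 1) * (q 2).coeff (n + 1) := by
    have := (hr 0).coeff_pos
    rw [h₂, coeff_sub, hcoeff, mul_assoc, coeff_C_mul, coeff_X_mul, pow_succ]
    have := mul_pos hg this
    linarith
  have hd1 : (q 1).natDegree ≤ n + 1 := by
    rw [h₁]
    exact natDegree_add_le_of_degree_le ((hd 1).trans n.le_succ)
      ((natDegree_C_mul_le _ _).trans hd2)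
  have hc1 : 0 < (-1) ^ (n + 1) * (q 1).coeff (n + 1) := by
    rw [h₁, coeff_add, hcoeff, coeff_C_mul, zero_add, mul_left_comm]
    positivity
  have hd0 : (q 0).natDegree ≤ n + 1 := by
    rw [h₀]
    exact natDegree_add_le_of_degree_le (natDegree_add_le_of_degree_le ((hd 0).trans n.le_succ)
      ((natDegree_C_mul_le _ _).trans ((hd 1).trans n.le_succ)))
      ((natDegree_C_mul_le _ _).trans hd2)
  have hc0 : 0 < (-1) ^ (n + 1) * (q 0).coeff (n + 1) := by
    rw [h₀, coeff_add, coeff_add, hcoeff, coeff_C_mul, hcoeff, coeff_C_mul, mul_zero, zero_add,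
      zero_add, mul_left_comm]
    positivity
  have hp0 : ∀ a, 0 < (p a).eval 0 := fun a => (hr a).eval_zero_pos (hz0 a)
  have hq20 : 0 < (q 2).eval 0 := by
    rw [h₂]
    simpa using hp0 2
  have hq10 : 0 < (q 1).eval 0 := by
    have := hp0 1
    rw [h₁]
    simp only [eval_add, eval_mul, eval_C]
    positivity
  have hq00 : 0 < (q 0).eval 0 := by
    have := hp0 0
    have := hp0 1
    rw [h₀]
    simp only [eval_add, eval_mul, eval_C]
    positivity
  -- the zeros of `q 2`
  obtain ⟨M, hMB, hM⟩ := exists_large_sign n.succ_pos hd2 hc2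
    (∑ j ∈ Finset.range n, ζ 0 j)
  have hMlt : ∀ j < n, ζ 0 j < M := fun j hj => lt_of_le_of_lt
    (Finset.single_le_sum (f := ζ 0) (fun i hi => (hz0 0 i (Finset.mem_range.1 hi)).le)
      (Finset.mem_range.2 hj)) hMB
  have hM0 : 0 < M := lt_of_le_of_lt
    (Finset.sum_nonneg fun i hi => (hz0 0 i (Finset.mem_range.1 hi)).le) hMB
  obtain ⟨μ, hμr, hμ⟩ := exists_hasRootSeq hd2 hq20
    (a := fun j => if j = 0 then 0 else ζ 0 (j - 1)) (b := fun j => if j < n then ζ 1 j else M)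
    (by
      intro j hj
      split_ifs with h
      · exact le_rfl
      · exact (hz0 0 (j - 1) (by omega)).le)
    (by
      intro j hj
      split_ifs with h h' h'
      · exact hz0 1 j h'
      · exact hM0
      · exact (h02 (j - 1) j (by omega) h').trans (h21 j h')
      · exact hMlt _ (by omega))
    (by
      intro j k hjk hk
      rw [if_pos (by omega : j < n), if_neg (by omega)]
      exact (h10 j (by omega)).le.trans (hle 0 _ _ (by omega) (by omega)))
    (by
      intro j hj
      split_ifs with h
      · simpa [h] using hq20
      · have h3 : (q 2).eval (ζ 0 (j - 1)) = (p 2).eval (ζ 0 (j - 1)) := by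
          rw [h₂]
          simp [(hr 0).eval_eq_zero (show j - 1 < n by omega)]
        rw [h3]
        refine (hr 2).sign_eval (by omega) (fun i hi => ?_) (fun i hi hi' => ?_)
        · exact (((h21 i (by omega)).trans (h10 i (by omega)))).trans_le
            (hle 0 _ _ (by omega) (by omega))
        · exact h02 _ _ (by omega) hi')
    (by
      intro j hj
      split_ifs with h
      · have h3 : (q 2).eval (ζ 1 j) = (p 2).eval (ζ 1 j) - g * ζ 1 j * (p 0).eval (ζ 1 j) := by
          rw [h₂]
          simp
        have h4 : 0 < (-1) ^ (j + 1) * (p 2).eval (ζ 1 j) := by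
          refine (hr 2).sign_eval (by omega) (fun i hi => ?_) (fun i hi hi' => ?_)
          · exact (hle 2 i j (by omega) h).trans_lt (h21 j h)
          · exact (h10 j h).trans (h02 _ _ (by omega) hi')
        have h5 : 0 < (-1) ^ j * (p 0).eval (ζ 1 j) := by
          refine (hr 0).sign_eval (by omega) (fun i hi => ?_) (fun i hi hi' => ?_)
          · exact (h02 i j hi h).trans (h21 j h)
          · exact (h10 j h).trans_le (hle 0 _ _ hi hi')
        have h6 := mul_pos (mul_pos hg (hz0 1 j h)) h5
        rw [h3, mul_sub]
        have h7 : (-1) ^ (j + 1) * (g * ζ 1 j * (p 0).eval (ζ 1 j)) =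
          -(g * ζ 1 j * ((-1) ^ j * (p 0).eval (ζ 1 j))) := by ring
        rw [h7]
        linarith
      · obtain rfl : j = n := by omega
        exact hM)
  have hμ1 : ∀ j < n, μ j < ζ 1 j := fun j hj => by
    have := (hμ j (by omega)).2
    rwa [if_pos hj] at this
  have hμ0 : ∀ j k, j < k → k < n + 1 → ζ 0 j < μ k := fun j k hjk hk => by
    have := (hμ k hk).1
    rw [if_neg (by omega)] at this
    exact (hle 0 j (k - 1) (by omega) (by omega)).trans_lt this
  have hμpos : ∀ j < n + 1, 0 < μ j := fun j hj => by
    have := (hμ j hj).1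
    split_ifs at this with h
    · exact this
    · exact (hz0 0 _ (by omega)).trans this
  have hμlt : ∀ j k, j < k → k < n + 1 → μ j < μ k := fun j k hjk hk =>
    ((hμ1 j (by omega)).trans (h10 j (by omega))).trans (hμ0 j k hjk hk)
  have hμle : ∀ j k, j ≤ k → k < n + 1 → μ j ≤ μ k := fun j k hjk hk =>
    hjk.eq_or_lt.elim (fun h => h ▸ le_rfl) fun h => (hμlt j k h hk).le
  -- the zeros of `q 1`
  obtain ⟨M₁, hMB₁, hM₁⟩ := exists_large_sign n.succ_pos hd1 hc1 (μ n)
  obtain ⟨ν, hνr, hν⟩ := exists_hasRootSeq hd1 hq10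
    (a := μ) (b := fun j => if j < n then ζ 1 j else M₁)
    (fun j hj => (hμpos j hj).le)
    (by
      intro j hj
      split_ifs with h
      · exact hμ1 j h
      · obtain rfl : j = n := by omega
        exact hMB₁)
    (by
      intro j k hjk hk
      rw [if_pos (by omega : j < n)]
      exact ((h10 j (by omega)).trans (hμ0 j k hjk hk)).le)
    (by
      intro j hj
      have h3 : (q 1).eval (μ j) = (p 1).eval (μ j) := by
        rw [h₁]
        simp [hμr.eval_eq_zero hj]
      rw [h3]
      refine (hr 1).sign_eval (by omega) (fun i hi => ?_) (fun i hi hi' => ?_)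
      · exact (h10 i (by omega)).trans (hμ0 i j hi hj)
      · exact (hμle j i hi (by omega)).trans_lt (hμ1 i hi'))
    (by
      intro j hj
      split_ifs with h
      · rw [h₁]
        refine neg_one_pow_eval_add_pos hℓ (by simp [(hr 1).eval_eq_zero h]) ?_
        refine hμr.sign_eval (by omega) (fun i hi => ?_) (fun i hi hi' => ?_)
        · exact (hμle i j (by omega) (by omega)).trans_lt (hμ1 j h)
        · exact (h10 j h).trans (hμ0 _ _ (by omega) hi')
      · obtain rfl : j = n := by omega
        exact hM₁)
  have hν1 : ∀ j < n, ν j < ζ 1 j := fun j hj => by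
    have := (hν j (by omega)).2
    rwa [if_pos hj] at this
  have hμν : ∀ j < n + 1, μ j < ν j := fun j hj => (hν j hj).1
  have hνlt : ∀ j k, j < k → k < n + 1 → ν j < ν k := fun j k hjk hk =>
    ((hν1 j (by omega)).trans (h10 j (by omega))).trans ((hμ0 j k hjk hk).trans (hμν k hk))
  have hνle : ∀ j k, j ≤ k → k < n + 1 → ν j ≤ ν k := fun j k hjk hk =>
    hjk.eq_or_lt.elim (fun h => h ▸ le_rfl) fun h => (hνlt j k h hk).le
  -- the zeros of `q 0`
  obtain ⟨M₀, hMB₀, hM₀⟩ := exists_large_sign n.succ_pos hd0 hc0 (ν n)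
  obtain ⟨η, hηr, hη⟩ := exists_hasRootSeq hd0 hq00
    (a := ν) (b := fun j => if j < n then ζ 0 j else M₀)
    (fun j hj => ((hμpos j hj).trans (hμν j hj)).le)
    (by
      intro j hj
      split_ifs with h
      · exact (hν1 j h).trans (h10 j h)
      · obtain rfl : j = n := by omega
        exact hMB₀)
    (by
      intro j k hjk hk
      rw [if_pos (by omega : j < n)]
      exact ((hμ0 j k hjk hk).trans (hμν k hk)).le)
    (by
      intro j hj
      have h3 : (q 0).eval (ν j) = (p 0 + C (ℓ / 2) * p 1).eval (ν j) := by
        have := hνr.eval_eq_zero hj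
        rw [h₁] at this
        rw [h₀]
        simp only [eval_add, eval_mul, eval_C] at this ⊢
        linear_combination ℓ / 2 * this
      rw [h3]
      refine neg_one_pow_eval_add_pos (by positivity) (le_of_lt ?_) ?_
      · refine (hr 0).sign_eval (by omega) (fun i hi => ?_) (fun i hi hi' => ?_)
        · exact (hμ0 i j hi hj).trans (hμν j hj)
        · exact (hνle j i hi (by omega)).trans_lt ((hν1 i hi').trans (h10 i hi'))
      · refine (hr 1).sign_eval (by omega) (fun i hi => ?_) (fun i hi hi' => ?_)
        · exact (h10 i (by omega)).trans ((hμ0 i j hi hj).trans (hμν j hj))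
        · exact (hνle j i hi (by omega)).trans_lt (hν1 i hi'))
    (by
      intro j hj
      split_ifs with h
      · rw [h₀]
        refine neg_one_pow_eval_add_pos (by positivity) (le_of_lt ?_) ?_
        · refine neg_one_pow_eval_add_pos hℓ (by simp [(hr 0).eval_eq_zero h]) ?_
          refine (hr 1).sign_eval (by omega) (fun i hi => ?_) (fun i hi hi' => ?_)
          · exact (hle 1 i j (by omega) h).trans_lt (h10 j h)
          · exact (h02 _ _ (by omega) hi').trans (h21 i hi')
        · refine hμr.sign_eval (by omega) (fun i hi => ?_) (fun i hi hi' => ?_)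
          · exact (hμle i j (by omega) (by omega)).trans_lt ((hμ1 j h).trans (h10 j h))
          · exact hμ0 _ _ (by omega) hi'
      · obtain rfl : j = n := by omega
        exact hM₀)
  refine ⟨![η, ν, μ], ?_, hμpos, hμν, fun j hj => (hη j hj).1, fun j k hjk hk => ?_⟩
  · intro a
    fin_cases a
    exacts [hηr, hνr, hμr]
  · have := (hη j (by omega)).2
    rw [if_pos (by omega)] at this
    exact this.trans (hμ0 j k hjk hk)

end Interlacing

section Interlacing

open Polynomial

theorem HasRootSeq.aeval_eq_zero_iff {p : ℝ[X]} {n : ℕ} {ζ : ℕ → ℝ} (h : HasRootSeq p n ζ)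
    (z : ℂ) : aeval z p = 0 ↔ ∃ j < n, z = ζ j := by
  obtain ⟨c, hc, rfl⟩ := h
  have hc' : (c : ℂ) ≠ 0 := by exact_mod_cast hc.ne'
  simp only [map_mul, aeval_C, map_prod, map_sub, aeval_X, Complex.coe_algebraMap, mul_eq_zero,
    hc', false_or, Finset.prod_eq_zero_iff, Finset.mem_range, sub_eq_zero]
  exact exists_congr fun j => and_congr_right fun _ => eq_comm

theorem HasRootSeq.eval_derivative_ne_zero {p : ℝ[X]} {n : ℕ} {ζ : ℕ → ℝ} (h : HasRootSeq p n ζ)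
    {j : ℕ} (hj : j < n) (hne : ∀ i < n, i ≠ j → ζ i ≠ ζ j) :
    (derivative p).eval (ζ j) ≠ 0 := by
  obtain ⟨c, hc, rfl⟩ := h
  rw [← Finset.mul_prod_erase _ _ (Finset.mem_range.2 hj)]
  simp only [derivative_mul, derivative_C, derivative_sub, derivative_X, eval_add, eval_mul,
    eval_sub, eval_C, eval_X, sub_self, zero_mul, zero_sub, zero_add, add_zero, eval_neg,
    eval_one, eval_prod]
  refine mul_ne_zero hc.ne' (mul_ne_zero (by norm_num) (Finset.prod_ne_zero_iff.2 fun i hi => ?_))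
  rw [Finset.mem_erase, Finset.mem_range] at hi
  exact sub_ne_zero.2 (hne i hi.2 hi.1)

/-- Polynomials of degrees `0, …, n-1` separate `n` distinct points. -/
theorem linearIndependent_eval_of_natDegree_eq {K : Type*} [Field K] {n : ℕ} {p : Fin n → K[X]}
    (hp : ∀ i, p i ≠ 0) (hd : ∀ i, (p i).natDegree = i) {ζ : Fin n → K}
    (hζ : Function.Injective ζ) : LinearIndependent K (fun j i => (p i).eval (ζ j)) := by
  have hl : ∀ i, (p i).leadingCoeff⁻¹ ≠ 0 := fun i => inv_ne_zero (leadingCoeff_ne_zero.2 (hp i))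
  have hdet := Matrix.det_eval_matrixOfPolynomials_eq_det_vandermonde ζ
    (fun i => C (p i).leadingCoeff⁻¹ * p i)
    (fun i => by rw [natDegree_C_mul (hl i), hd])
    (fun i => monic_C_mul_of_mul_leadingCoeff_eq_one
      (inv_mul_cancel₀ (leadingCoeff_ne_zero.2 (hp i))))
  have h := Matrix.linearIndependent_rows_of_det_ne_zero
    (hdet ▸ Matrix.det_vandermonde_ne_zero_iff.2 hζ)
  rw [Fintype.linearIndependent_iff] at h ⊢
  intro c hc
  refine h c ?_
  ext i
  have := congrFun hc i
  simp only [Finset.sum_apply, Pi.smul_apply, smul_eq_mul, Pi.zero_apply] at this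
  simp only [Finset.sum_apply, Pi.smul_apply, smul_eq_mul, Pi.zero_apply, eval_mul,
    eval_C, Matrix.of_apply]
  simp_rw [mul_left_comm _ (p i).leadingCoeff⁻¹]
  rw [← Finset.mul_sum, this, mul_zero]

end Interlacing

section StringPolynomials

open Polynomial

/-- The derivatives of order `0`, `1`, `2` of `s ↦ s² / 2`. -/
noncomputable def halfSq (a : Fin 3) (s : ℝ) : ℝ := ![s ^ 2 / 2, s, 1] a

@[simp] theorem halfSq_zero (s : ℝ) : halfSq 0 s = s ^ 2 / 2 := rfl
@[simp] theorem halfSq_one (s : ℝ) : halfSq 1 s = s := rfl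
@[simp] theorem halfSq_two (s : ℝ) : halfSq 2 s = 1 := rfl

/-- The value at the `k`-th mass of the solution of the initial value problem for masses `g` at
the points `x`, as a polynomial in the spectral parameter. -/
noncomputable def nodalPoly (g x : ℕ → ℝ) (k : ℕ) : ℝ[X] :=
  C (halfSq 0 (x k)) - X * ∑ j : Fin k, C (g j * halfSq 0 (x k - x j)) * nodalPoly g x j
termination_by k
decreasing_by exact j.2

/-- The derivative of order `a` at `t` of the solution of the initial value problem with the first
`k` masses only, continued analytically to the right of these, as a polynomial in the spectral
parameter. -/
noncomputable def stringPoly (g x : ℕ → ℝ) (k : ℕ) (a : Fin 3) (t : ℝ) : ℝ[X] :=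
  C (halfSq a t) - X * ∑ j ∈ Finset.range k, C (g j * halfSq a (t - x j)) * nodalPoly g x j

variable {g x : ℕ → ℝ}

theorem nodalPoly_eq (k : ℕ) : nodalPoly g x k = stringPoly g x k 0 (x k) := by
  rw [nodalPoly, stringPoly, Finset.sum_range]

theorem stringPoly_succ (k : ℕ) (a : Fin 3) (t : ℝ) :
    stringPoly g x (k + 1) a t =
      stringPoly g x k a t - C (g k * halfSq a (t - x k)) * X * nodalPoly g x k := by
  rw [stringPoly, stringPoly, Finset.sum_range_succ]
  ring

theorem stringPoly_one_shift (k : ℕ) (s t : ℝ) :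
    stringPoly g x k 1 t = stringPoly g x k 1 s + C (t - s) * stringPoly g x k 2 s := by
  induction k with
  | zero => simp [stringPoly]
  | succ k ih =>
    rw [stringPoly_succ, stringPoly_succ, stringPoly_succ, ih]
    simp
    ring

theorem stringPoly_two_shift (k : ℕ) (s t : ℝ) :
    stringPoly g x k 2 t = stringPoly g x k 2 s := by
  simp [stringPoly]

theorem stringPoly_zero_shift (k : ℕ) (s t : ℝ) :
    stringPoly g x k 0 t = stringPoly g x k 0 s + C (t - s) * stringPoly g x k 1 s +
      C ((t - s) ^ 2 / 2) * stringPoly g x k 2 s := by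
  induction k with
  | zero =>
    simp only [stringPoly, halfSq_zero, halfSq_one, halfSq_two, Finset.range_zero,
      Finset.sum_empty, mul_zero, sub_zero, ← C_mul, ← C_add]
    congr 1
    ring
  | succ k ih =>
    have h : C (g k * halfSq 0 (t - x k)) = C (g k * halfSq 0 (s - x k)) +
        C (t - s) * C (g k * halfSq 1 (s - x k)) +
        C ((t - s) ^ 2 / 2) * C (g k * halfSq 2 (s - x k)) := by
      simp only [halfSq_zero, halfSq_one, halfSq_two, ← C_mul, ← C_add]
      congr 1
      ring
    rw [stringPoly_succ, stringPoly_succ, stringPoly_succ, stringPoly_succ, ih, h]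
    ring

theorem exists_interlaced_stringPoly (k : ℕ) (hg : ∀ j < k, 0 < g j) (hx0 : ∀ j < k, 0 < x j)
    (hx : ∀ i j, i < j → j < k → x i < x j) {t : ℝ} (ht0 : 0 < t) (ht : ∀ j < k, x j < t) :
    ∃ ζ, Interlaced k (fun a => stringPoly g x k a t) ζ := by
  induction k generalizing t with
  | zero =>
    refine ⟨fun _ _ => 0, fun a => ⟨halfSq a t, ?_, by simp [stringPoly]⟩, by simp, by simp,
      by simp, by simp⟩
    fin_cases a <;> simp <;> positivity
  | succ k ih =>
    obtain ⟨ζ, hζ⟩ := ih (fun j hj => hg j (by omega)) (fun j hj => hx0 j (by omega))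
      (fun i j hij hj => hx i j hij (by omega)) (hx0 k k.lt_succ_self)
      (fun j hj => hx j k hj k.lt_succ_self)
    refine hζ.step (hg k k.lt_succ_self) (sub_pos.2 (ht k k.lt_succ_self)) ?_ ?_ ?_
    · rw [stringPoly_succ, ← nodalPoly_eq, stringPoly_two_shift k (x k) t]
      simp
    · rw [stringPoly_one_shift _ (x k) t, stringPoly_two_shift _ (x k) t, stringPoly_succ k 1]
      simp
    · rw [stringPoly_zero_shift _ (x k) t, stringPoly_two_shift _ (x k) t, stringPoly_succ k 1,
        stringPoly_succ k 0]
      simp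

/-- The Lagrange identity for the bilinear concomitant `φ' ψ' - φ'' ψ - φ ψ''`. -/
theorem lagrange_identity (z w : ℂ) (k : ℕ) (t : ℝ) :
    (z + w) * ∑ j ∈ Finset.range k,
        (g j : ℂ) * (aeval z (nodalPoly g x j) * aeval w (nodalPoly g x j)) =
      aeval z (stringPoly g x k 1 t) * aeval w (stringPoly g x k 1 t) -
        aeval z (stringPoly g x k 2 t) * aeval w (stringPoly g x k 0 t) -
        aeval z (stringPoly g x k 0 t) * aeval w (stringPoly g x k 2 t) := by
  induction k generalizing t with
  | zero =>
    simp [stringPoly]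
    ring
  | succ k ih =>
    rw [stringPoly_zero_shift _ (x k) t, stringPoly_two_shift _ (x k) t,
      stringPoly_one_shift _ (x k) t, stringPoly_succ, stringPoly_succ, stringPoly_succ,
      Finset.sum_range_succ, mul_add, ih (x k), nodalPoly_eq]
    simp
    ring

theorem aeval_stringPoly (z : ℂ) (k : ℕ) (a : Fin 3) (t : ℝ) :
    aeval z (stringPoly g x k a t) = (halfSq a t : ℂ) - z * ∑ j ∈ Finset.range k,
      (g j : ℂ) * aeval z (nodalPoly g x j) * (halfSq a (t - x j) : ℂ) := by
  simp only [stringPoly, map_sub, aeval_C, map_mul, aeval_X, map_sum, Complex.coe_algebraMap]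
  congr 2
  exact Finset.sum_congr rfl fun j _ => by ring

end StringPolynomials

section TestFunctions

/-- Test functions on the open unit interval. -/
structure IsTest (ψ : ℝ → ℝ) : Prop where
  contDiff : ContDiff ℝ (⊤ : ℕ∞) ψ
  hasCompactSupport : HasCompactSupport ψ
  tsupport_subset : tsupport ψ ⊆ Ioo 0 1

theorem IsTest.deriv {ψ : ℝ → ℝ} (h : IsTest ψ) : IsTest (deriv ψ) :=
  ⟨(contDiff_infty_iff_deriv.1 h.contDiff).2, h.hasCompactSupport.deriv,
    tsupport_deriv_subset.trans h.tsupport_subset⟩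

theorem IsTest.iteratedDeriv {ψ : ℝ → ℝ} (h : IsTest ψ) (k : ℕ) : IsTest (iteratedDeriv k ψ) := by
  induction k with
  | zero => simpa using h
  | succ k ih => rw [iteratedDeriv_succ]; exact ih.deriv

theorem IsTest.differentiable {ψ : ℝ → ℝ} (h : IsTest ψ) : Differentiable ℝ ψ :=
  (contDiff_infty_iff_deriv.1 h.contDiff).1

theorem IsTest.continuous {ψ : ℝ → ℝ} (h : IsTest ψ) : Continuous ψ :=
  h.differentiable.continuous

theorem IsTest.eq_zero {ψ : ℝ → ℝ} (h : IsTest ψ) {t : ℝ} (ht : t ∉ Ioo (0 : ℝ) 1) : ψ t = 0 :=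
  image_eq_zero_of_notMem_tsupport fun h' => ht (h.tsupport_subset h')

theorem IsTest.integral_eq {ψ : ℝ → ℝ} (h : IsTest ψ) : ∫ t in (0 : ℝ)..1, ψ t = ∫ t, ψ t :=
  intervalIntegral.integral_eq_integral_of_support_subset
    ((subset_tsupport ψ).trans (h.tsupport_subset.trans Ioo_subset_Ioc_self))

theorem IsTest.sub_smul {ψ θ : ℝ → ℝ} (h : IsTest ψ) (h' : IsTest θ) (c : ℝ) :
    IsTest (ψ - c • θ) := by
  refine ⟨h.contDiff.sub (contDiff_const.smul h'.contDiff),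
    h.hasCompactSupport.sub (h'.hasCompactSupport.smul_left (f := fun _ => c)),
    (tsupport_sub _ _).trans (union_subset h.tsupport_subset ?_)⟩
  exact (closure_mono (Function.support_const_smul_subset c θ)).trans h'.tsupport_subset

theorem exists_isTest_integral_eq_one : ∃ θ, IsTest θ ∧ ∫ t in (0 : ℝ)..1, θ t = 1 := by
  let f : ContDiffBump (1 / 2 : ℝ) := ⟨1 / 8, 1 / 4, by norm_num, by norm_num⟩
  have h : IsTest (f.normed volume) := by
    refine ⟨f.contDiff_normed, f.hasCompactSupport_normed, ?_⟩
    rw [f.tsupport_normed_eq, Real.closedBall_eq_Icc]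
    exact Icc_subset_Ioo (by norm_num [f]) (by norm_num [f])
  exact ⟨_, h, h.integral_eq.trans f.integral_normed⟩

theorem IsTest.exists_antideriv {χ : ℝ → ℝ} (h : IsTest χ) (h0 : ∫ t in (0 : ℝ)..1, χ t = 0) :
    ∃ ψ, IsTest ψ ∧ _root_.deriv ψ = χ := by
  have hd : ∀ s, HasDerivAt (fun s => ∫ t in (0 : ℝ)..s, χ t) (χ s) s := fun s =>
    intervalIntegral.integral_hasDerivAt_right (h.continuous.intervalIntegrable _ _)
      h.continuous.stronglyMeasurable.stronglyMeasurableAtFilter h.continuous.continuousAt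
  have hderiv : _root_.deriv (fun s => ∫ t in (0 : ℝ)..s, χ t) = χ := funext fun s => (hd s).deriv
  obtain ⟨a, b, hab, ha⟩ : ∃ a b : ℝ, Icc a b ⊆ Ioo 0 1 ∧ tsupport χ ⊆ Icc a b := by
    rcases (tsupport χ).eq_empty_or_nonempty with he | hne
    · exact ⟨1, 0, by simp, by simp [he]⟩
    · have hK : IsCompact (tsupport χ) := h.hasCompactSupport
      refine ⟨sInf (tsupport χ), sSup (tsupport χ), ?_, fun t ht =>
        ⟨csInf_le hK.bddBelow ht, le_csSup hK.bddAbove ht⟩⟩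
      exact Icc_subset_Ioo (h.tsupport_subset (hK.sInf_mem hne)).1
        (h.tsupport_subset (hK.sSup_mem hne)).2
  have hz : ∀ t, t ∉ Icc a b → χ t = 0 := fun t ht =>
    image_eq_zero_of_notMem_tsupport fun h' => ht (ha h')
  have hsupp : Function.support (fun s => ∫ t in (0 : ℝ)..s, χ t) ⊆ Icc a b := by
    intro s hs
    by_contra hs'
    refine hs ?_
    have hcases : s < a ∨ b < s := by
      by_contra! hc
      exact hs' hc
    by_cases hne : a ≤ b
    · have ha0 := hab (left_mem_Icc.2 hne)
      have hb0 := hab (right_mem_Icc.2 hne)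
      rcases hcases with hc | hc
      · refine intervalIntegral.integral_zero_ae (Filter.Eventually.of_forall fun t ht => hz t ?_)
        rintro ⟨h1, -⟩
        rcases uIoc_subset_uIcc ht with ⟨-, h2⟩
        rcases le_sup_iff.1 h2 with h2 | h2 <;> linarith [ha0.1]
      · have h3 : ∫ t in s..1, χ t = 0 := by
          refine intervalIntegral.integral_zero_ae
            (Filter.Eventually.of_forall fun t ht => hz t ?_)
          rintro ⟨-, h1⟩
          rcases uIoc_subset_uIcc ht with ⟨h2, -⟩
          rcases inf_le_iff.1 h2 with h2 | h2 <;> linarith [hb0.2]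
        have h4 := intervalIntegral.integral_add_adjacent_intervals
          (h.continuous.intervalIntegrable (μ := volume) 0 s)
          (h.continuous.intervalIntegrable (μ := volume) s 1)
        rw [h3, h0, add_zero] at h4
        exact h4
    · refine intervalIntegral.integral_zero_ae (Filter.Eventually.of_forall fun t _ => hz t ?_)
      rw [Icc_eq_empty hne]
      exact notMem_empty t
  refine ⟨fun s => ∫ t in (0 : ℝ)..s, χ t, ⟨?_, ?_, ?_⟩, hderiv⟩
  · exact contDiff_infty_iff_deriv.2 ⟨fun s => (hd s).differentiableAt, by
      rw [hderiv]; exact h.contDiff⟩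
  · exact HasCompactSupport.of_support_subset_isCompact isCompact_Icc hsupp
  · exact (closure_minimal hsupp isClosed_Icc).trans hab

/-- A functional on test functions with zero derivative is a constant. -/
theorem exists_eq_const_mul_integral {L : (ℝ → ℝ) → ℂ}
    (hL : ∀ χ θ, IsTest χ → IsTest θ → ∀ c : ℝ, L (χ - c • θ) = L χ - c * L θ)
    (h0 : ∀ ψ, IsTest ψ → L (deriv ψ) = 0) :
    ∃ c : ℂ, ∀ χ, IsTest χ → L χ = c * ((∫ t in (0 : ℝ)..1, χ t : ℝ) : ℂ) := by
  obtain ⟨θ, hθ, hθ1⟩ := exists_isTest_integral_eq_one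
  refine ⟨L θ, fun χ hχ => ?_⟩
  have hi : ∫ t in (0 : ℝ)..1, (χ - (∫ t in (0 : ℝ)..1, χ t) • θ) t = 0 := by
    simp only [Pi.sub_apply, Pi.smul_apply, smul_eq_mul]
    rw [intervalIntegral.integral_sub (hχ.continuous.intervalIntegrable _ _)
      ((hθ.continuous.const_mul _).intervalIntegrable _ _),
      intervalIntegral.integral_const_mul, hθ1, mul_one, sub_self]
  obtain ⟨ψ, hψ, hψ'⟩ := (hχ.sub_smul hθ _).exists_antideriv hi
  have := h0 ψ hψ
  rw [hψ', hL χ θ hχ hθ, sub_eq_zero] at this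
  rw [this, mul_comm]

theorem IsTest.integral_pow_mul_deriv {ψ : ℝ → ℝ} (h : IsTest ψ) (k : ℕ) :
    ∫ t in (0 : ℝ)..1, t ^ (k + 1) * _root_.deriv ψ t =
      -((k + 1) * ∫ t in (0 : ℝ)..1, t ^ k * ψ t) := by
  rw [intervalIntegral.integral_mul_deriv_eq_deriv_mul (v := ψ)
    (u' := fun t => (k + 1) * t ^ k) (fun t _ => by simpa using hasDerivAt_pow (k + 1) t)
    (fun t _ => (h.differentiable t).hasDerivAt)
    (Continuous.intervalIntegrable (by fun_prop) _ _)
    (h.deriv.continuous.intervalIntegrable _ _), h.eq_zero (by simp), h.eq_zero (by simp),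
    ← intervalIntegral.integral_const_mul]
  simp [mul_assoc]

theorem IsTest.integral_pow_mul_iteratedDeriv {ψ : ℝ → ℝ} (h : IsTest ψ) (k : ℕ) :
    ∫ t in (0 : ℝ)..1, t ^ k * _root_.iteratedDeriv k ψ t =
      (-1) ^ k * k.factorial * ∫ t in (0 : ℝ)..1, ψ t := by
  induction k with
  | zero => simp
  | succ k ih =>
    rw [iteratedDeriv_succ, (h.iteratedDeriv k).integral_pow_mul_deriv, ih]
    push_cast [Nat.factorial_succ]
    ring

theorem intervalIntegrable_mul_test {f : ℝ → ℂ} (hf : ContinuousOn f (Icc 0 1)) {ψ : ℝ → ℝ}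
    (hψ : Continuous ψ) : IntervalIntegrable (fun t => f t * (ψ t : ℂ)) volume 0 1 := by
  refine ContinuousOn.intervalIntegrable ?_
  rw [uIcc_of_le zero_le_one]
  exact hf.mul (Complex.continuous_ofReal.comp hψ).continuousOn

/-- **Du Bois-Reymond lemma**: a continuous function whose derivative of order `k`, in the sense of
distributions, vanishes, is a polynomial of degree less than `k`. -/
theorem eqOn_sum_pow_of_integral_mul_iteratedDeriv (k : ℕ) {f : ℝ → ℂ}
    (hf : ContinuousOn f (Icc 0 1))
    (h : ∀ ψ, IsTest ψ → ∫ t in (0 : ℝ)..1, f t * ((iteratedDeriv k ψ t : ℝ) : ℂ) = 0) :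
    ∃ c : ℕ → ℂ, EqOn f (fun t => ∑ i ∈ Finset.range k, c i * (t : ℂ) ^ i) (Icc 0 1) := by
  induction k generalizing f with
  | zero =>
    refine ⟨0, ?_⟩
    have hae : ∀ᵐ t : ℝ, t ∈ Ioo (0 : ℝ) 1 → f t = 0 := by
      refine isOpen_Ioo.ae_eq_zero_of_integral_contDiff_smul_eq_zero
        ((hf.mono Ioo_subset_Icc_self).locallyIntegrableOn measurableSet_Ioo) ?_
      intro ψ h1 h2 h3
      rw [← h ψ ⟨h1, h2, h3⟩, intervalIntegral.integral_eq_integral_of_support_subset]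
      · simp [mul_comm]
      · intro t ht
        refine Ioo_subset_Ioc_self (h3 (subset_tsupport ψ ?_))
        intro h4
        simp [h4] at ht
    refine Measure.eqOn_Icc_of_ae_eq volume zero_ne_one ?_ hf (by simp [continuousOn_const])
    rw [← restrict_Ioo_eq_restrict_Icc, Filter.EventuallyEq, ae_restrict_iff' measurableSet_Ioo]
    simpa using hae
  | succ k ih =>
    obtain ⟨c, hc⟩ := exists_eq_const_mul_integral
      (L := fun χ => ∫ t in (0 : ℝ)..1, f t * ((iteratedDeriv k χ t : ℝ) : ℂ))
      (by
        intro χ θ hχ hθ c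
        rw [← intervalIntegral.integral_const_mul, ← intervalIntegral.integral_sub
          (intervalIntegrable_mul_test hf (hχ.iteratedDeriv k).continuous)
          ((intervalIntegrable_mul_test hf (hθ.iteratedDeriv k).continuous).const_mul _)]
        refine intervalIntegral.integral_congr fun t _ => ?_
        have h1 : ContDiffAt ℝ k χ t := (hχ.contDiff.of_le (by exact_mod_cast le_top)).contDiffAt
        have h2 : ContDiffAt ℝ k θ t := (hθ.contDiff.of_le (by exact_mod_cast le_top)).contDiffAt
        have h3 : ContDiffAt ℝ k (c • θ) t := h2.const_smul c
        rw [iteratedDeriv_sub h1 h3, iteratedDeriv_const_smul h2]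
        push_cast [smul_eq_mul]
        ring)
      (fun ψ hψ => by
        rw [← iteratedDeriv_succ']
        exact h ψ hψ)
    have hk : ((-1) ^ k * k.factorial : ℂ) ≠ 0 := by
      have := k.factorial_ne_zero
      simp [this]
    obtain ⟨d, hd⟩ := ih (f := fun t => f t - c / ((-1) ^ k * k.factorial) * (t : ℂ) ^ k)
      (hf.sub (by fun_prop)) (by
        intro ψ hψ
        have h1 : ∀ t : ℝ, (f t - c / ((-1) ^ k * k.factorial) * (t : ℂ) ^ k) *
            ((iteratedDeriv k ψ t : ℝ) : ℂ) = f t * ((iteratedDeriv k ψ t : ℝ) : ℂ) -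
              c / ((-1) ^ k * k.factorial) * ((t ^ k * iteratedDeriv k ψ t : ℝ) : ℂ) := by
          intro t
          push_cast
          ring
        simp_rw [h1]
        have h2 : Continuous fun t : ℝ => ((t ^ k * iteratedDeriv k ψ t : ℝ) : ℂ) :=
          Complex.continuous_ofReal.comp ((continuous_pow k).mul (hψ.iteratedDeriv k).continuous)
        rw [intervalIntegral.integral_sub
          (intervalIntegrable_mul_test hf (hψ.iteratedDeriv k).continuous)
          ((h2.const_mul _).intervalIntegrable _ _), intervalIntegral.integral_const_mul,
          intervalIntegral.integral_ofReal, hψ.integral_pow_mul_iteratedDeriv, hc ψ hψ]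
        push_cast
        rw [← mul_assoc, div_mul_cancel₀ _ hk, sub_self])
    refine ⟨fun i => if i = k then c / ((-1) ^ k * k.factorial) else d i, fun t ht => ?_⟩
    have h1 := hd ht
    dsimp only at h1 ⊢
    rw [Finset.sum_range_succ, if_pos rfl, Finset.sum_congr rfl fun i hi => by
      rw [if_neg (Finset.mem_range.1 hi).ne], ← h1]
    ring

/-- The truncated power `(s₊)² / 2`. -/
noncomputable def truncSq (s : ℝ) : ℝ := halfSq 0 (max s 0)

theorem truncSq_of_nonneg {s : ℝ} (h : 0 ≤ s) : truncSq s = halfSq 0 s := by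
  rw [truncSq, max_eq_left h]

theorem truncSq_of_nonpos {s : ℝ} (h : s ≤ 0) : truncSq s = 0 := by
  simp [truncSq, max_eq_right h]

theorem continuous_truncSq : Continuous truncSq := by
  unfold truncSq
  simp only [halfSq_zero]
  fun_prop

theorem IsTest.integral_truncSq_mul {ψ : ℝ → ℝ} (h : IsTest ψ) {y : ℝ} (hy : y ∈ Ioo (0 : ℝ) 1) :
    ∫ t in (0 : ℝ)..1, truncSq (t - y) * _root_.iteratedDeriv 3 ψ t = -ψ y := by
  have hd : ∀ k t, HasDerivAt (_root_.iteratedDeriv k ψ) (_root_.iteratedDeriv (k + 1) ψ t) t := by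
    intro k t
    rw [iteratedDeriv_succ]
    exact ((h.iteratedDeriv k).differentiable t).hasDerivAt
  have hc : Continuous fun t => truncSq (t - y) * _root_.iteratedDeriv 3 ψ t :=
    (continuous_truncSq.comp (by fun_prop)).mul (h.iteratedDeriv 3).continuous
  have h1 : ∫ t in (0 : ℝ)..y, truncSq (t - y) * _root_.iteratedDeriv 3 ψ t = 0 := by
    refine intervalIntegral.integral_zero_ae (Filter.Eventually.of_forall fun t ht => ?_)
    rw [uIoc_of_le hy.1.le] at ht
    rw [truncSq_of_nonpos (sub_nonpos.2 ht.2), zero_mul]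
  have h2 : ∫ t in y..1, truncSq (t - y) * _root_.iteratedDeriv 3 ψ t =
      ∫ t in y..1, (t - y) ^ 2 / 2 * _root_.iteratedDeriv 3 ψ t := by
    refine intervalIntegral.integral_congr fun t ht => ?_
    rw [uIcc_of_le hy.2.le] at ht
    rw [truncSq_of_nonneg (sub_nonneg.2 ht.1), halfSq_zero]
  have h3 : ∫ t in y..1, (t - y) ^ 2 / 2 * _root_.iteratedDeriv 3 ψ t =
      ((1 - y) ^ 2 / 2 * _root_.iteratedDeriv 2 ψ 1 - (1 - y) * _root_.iteratedDeriv 1 ψ 1 +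
        _root_.iteratedDeriv 0 ψ 1) -
      ((y - y) ^ 2 / 2 * _root_.iteratedDeriv 2 ψ y - (y - y) * _root_.iteratedDeriv 1 ψ y +
        _root_.iteratedDeriv 0 ψ y) := by
    refine intervalIntegral.integral_eq_sub_of_hasDerivAt (f := fun t =>
      (t - y) ^ 2 / 2 * _root_.iteratedDeriv 2 ψ t - (t - y) * _root_.iteratedDeriv 1 ψ t +
        _root_.iteratedDeriv 0 ψ t) (fun t _ => ?_) ?_
    · have e1 : HasDerivAt (fun t => t - y) 1 t := (hasDerivAt_id t).sub_const y
      have e2 := (((e1.pow 2).div_const 2).mul (hd 2 t)).sub (e1.mul (hd 1 t)) |>.add (hd 0 t)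
      refine e2.congr_deriv ?_
      simp
      ring
    · refine Continuous.intervalIntegrable ?_ _ _
      exact (by fun_prop : Continuous fun t => (t - y) ^ 2 / 2).mul (h.iteratedDeriv 3).continuous
  rw [← intervalIntegral.integral_add_adjacent_intervals (hc.intervalIntegrable 0 y)
    (hc.intervalIntegrable y 1), h1, h2, h3, (h.iteratedDeriv 2).eq_zero (by simp),
    (h.iteratedDeriv 1).eq_zero (by simp), (h.iteratedDeriv 0).eq_zero (by simp)]
  simp

end TestFunctions

section EndPoints

theorem stringDeriv_of_eventuallyEq {f : ℝ → ℂ} {t : ℝ} (ht : t ∈ Icc (0 : ℝ) 1)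
    {A B C : ℂ} (h : f =ᶠ[nhdsWithin t (Icc 0 1)]
      fun s => A + B * ((s - t : ℝ) : ℂ) + C * ((s - t : ℝ) : ℂ) ^ 2 / 2) :
    stringDeriv 0 f t = A ∧ stringDeriv 1 f t = B ∧ stringDeriv 2 f t = C := by
  have hs : ∀ s : ℝ, HasDerivAt (fun s : ℝ => ((s - t : ℝ) : ℂ)) 1 s := fun s => by
    simpa using ((hasDerivAt_id s).sub_const t).ofReal_comp
  have h1 : deriv (fun s : ℝ => A + B * ((s - t : ℝ) : ℂ) + C * ((s - t : ℝ) : ℂ) ^ 2 / 2) =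
      fun s : ℝ => B + C * ((s - t : ℝ) : ℂ) := by
    funext s
    have e := (((hs s).const_mul B).const_add A).add ((((hs s).pow 2).const_mul C).div_const 2)
    refine (e.congr_deriv ?_).deriv
    simp
    ring
  have h2 : deriv (fun s : ℝ => B + C * ((s - t : ℝ) : ℂ)) = fun s : ℝ => C := by
    funext s
    exact ((((hs s).const_mul C).const_add B).congr_deriv (mul_one C)).deriv
  have h3 : ∀ k, stringDeriv k f t = iteratedDeriv k
      (fun s : ℝ => A + B * ((s - t : ℝ) : ℂ) + C * ((s - t : ℝ) : ℂ) ^ 2 / 2) t := by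
    intro k
    rw [stringDeriv, h.iteratedDerivWithin_eq (h.self_of_nhdsWithin ht),
      iteratedDerivWithin_eq_iteratedDeriv (uniqueDiffOn_Icc zero_lt_one) _ ht]
    have hc : ContDiff ℝ k fun s : ℝ => ((s - t : ℝ) : ℂ) :=
      Complex.ofRealCLM.contDiff.comp (contDiff_id.sub contDiff_const)
    exact ((contDiff_const.add (contDiff_const.mul hc)).add
      ((contDiff_const.mul (hc.pow 2)).div_const 2)).contDiffAt
  refine ⟨?_, ?_, ?_⟩
  · rw [h3]
    simp
  · rw [h3, iteratedDeriv_one, h1]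
    simp
  · rw [h3, iteratedDeriv_succ, iteratedDeriv_one, h1, h2]

end EndPoints

namespace DiscreteCubicString

open Polynomial

variable {n : ℕ} (S : DiscreteCubicString n)

/-- The masses, extended by zero to a sequence. -/
noncomputable def gSeq (k : ℕ) : ℝ := if h : k < n then S.g ⟨k, h⟩ else 0

/-- The positions of the masses, extended by zero to a sequence. -/
noncomputable def xSeq (k : ℕ) : ℝ := if h : k < n then S.x ⟨k, h⟩ else 0

theorem gSeq_pos {k : ℕ} (hk : k < n) : 0 < S.gSeq k := by
  rw [gSeq, dif_pos hk]
  exact S.g_pos _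

theorem xSeq_mem {k : ℕ} (hk : k < n) : S.xSeq k ∈ Ioo (0 : ℝ) 1 := by
  rw [xSeq, dif_pos hk]
  exact S.x_mem _

theorem xSeq_mem_Icc {k : ℕ} (hk : k < n) : S.xSeq k ∈ Icc (0 : ℝ) 1 :=
  Ioo_subset_Icc_self (S.xSeq_mem hk)

theorem xSeq_lt {i j : ℕ} (hij : i < j) (hj : j < n) : S.xSeq i < S.xSeq j := by
  rw [xSeq, xSeq, dif_pos hj, dif_pos (hij.trans hj)]
  exact S.x_strictMono hij

theorem xSeq_le {i j : ℕ} (hij : i ≤ j) (hj : j < n) : S.xSeq i ≤ S.xSeq j :=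
  hij.eq_or_lt.elim (fun h => h ▸ le_rfl) fun h => (S.xSeq_lt h hj).le

theorem integral_mass (f : ℝ → ℂ) :
    ∫ ξ, f ξ ∂S.mass = ∑ j ∈ Finset.range n, (S.gSeq j : ℂ) * f (S.xSeq j) := by
  rw [mass, integral_finsetSum_measure, Finset.sum_range]
  · refine Finset.sum_congr rfl fun i _ => ?_
    rw [integral_smul_measure, integral_dirac, ENNReal.toReal_ofReal (S.g_pos i).le, gSeq, xSeq,
      dif_pos i.2, dif_pos i.2, Complex.real_smul]
  · intro i _
    exact (integrable_dirac (by simp)).smul_measure ENNReal.ofReal_ne_top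

theorem of_ae_mass {P : ℝ → Prop} (h : ∀ᵐ ξ ∂S.mass, P ξ) {j : ℕ} (hj : j < n) :
    P (S.xSeq j) := by
  by_contra hP
  rw [ae_iff, mass, Measure.finsetSum_apply, Finset.sum_eq_zero_iff] at h
  have h1 := h ⟨j, hj⟩ (Finset.mem_univ _)
  rw [xSeq, dif_pos hj] at hP
  rw [Measure.smul_apply, Measure.dirac_apply_of_mem (by exact hP), smul_eq_mul, mul_one,
    ENNReal.ofReal_eq_zero] at h1
  exact absurd (S.g_pos ⟨j, hj⟩) h1.not_gt

theorem sum_truncSq_eq {k : ℕ} (hk : k ≤ n) {ξ : ℝ} (h₁ : ∀ j < k, S.xSeq j ≤ ξ)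
    (h₂ : ∀ j, k ≤ j → j < n → ξ ≤ S.xSeq j) (m : ℕ → ℂ) :
    ∑ j ∈ Finset.range n, m j * (truncSq (ξ - S.xSeq j) : ℂ) =
      ∑ j ∈ Finset.range k, m j * (halfSq 0 (ξ - S.xSeq j) : ℂ) := by
  rw [← Finset.sum_subset (Finset.range_mono hk)]
  · refine Finset.sum_congr rfl fun j hj => ?_
    rw [truncSq_of_nonneg (sub_nonneg.2 (h₁ j (Finset.mem_range.1 hj)))]
  · intro j hj hj'
    rw [truncSq_of_nonpos, Complex.ofReal_zero, mul_zero]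
    exact sub_nonpos.2 (h₂ j (by simpa using hj') (Finset.mem_range.1 hj))

theorem continuous_sum_truncSq (m : ℕ → ℂ) :
    Continuous fun ξ : ℝ => ∑ j ∈ Finset.range n, m j * (truncSq (ξ - S.xSeq j) : ℂ) :=
  continuous_finsetSum _ fun _ _ => continuous_const.mul
    (Complex.continuous_ofReal.comp (continuous_truncSq.comp (continuous_sub_right _)))

theorem integral_sum_truncSq_mul (m : ℕ → ℂ) {ψ : ℝ → ℝ} (h : IsTest ψ) :
    ∫ ξ in (0 : ℝ)..1, (∑ j ∈ Finset.range n, m j * (truncSq (ξ - S.xSeq j) : ℂ)) *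
        ((iteratedDeriv 3 ψ ξ : ℝ) : ℂ) =
      -∑ j ∈ Finset.range n, m j * (ψ (S.xSeq j) : ℂ) := by
  have h1 : ∀ ξ : ℝ, (∑ j ∈ Finset.range n, m j * (truncSq (ξ - S.xSeq j) : ℂ)) *
        ((iteratedDeriv 3 ψ ξ : ℝ) : ℂ) = ∑ j ∈ Finset.range n,
          m j * ((truncSq (ξ - S.xSeq j) * iteratedDeriv 3 ψ ξ : ℝ) : ℂ) := by
    intro ξ
    rw [Finset.sum_mul]
    exact Finset.sum_congr rfl fun j _ => by push_cast; ring
  simp_rw [h1]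
  rw [intervalIntegral.integral_finsetSum, ← Finset.sum_neg_distrib]
  · refine Finset.sum_congr rfl fun j hj => ?_
    rw [intervalIntegral.integral_const_mul, intervalIntegral.integral_ofReal,
      h.integral_truncSq_mul (S.xSeq_mem (Finset.mem_range.1 hj))]
    simp
  · intro j _
    refine Continuous.intervalIntegrable ?_ _ _
    exact continuous_const.mul (Complex.continuous_ofReal.comp
      ((continuous_truncSq.comp (continuous_sub_right _)).mul (h.iteratedDeriv 3).continuous))

/-- The solution of the initial value problem. -/
noncomputable def solution (z : ℂ) (ξ : ℝ) : ℂ :=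
  (halfSq 0 ξ : ℂ) - z * ∑ j ∈ Finset.range n,
    (S.gSeq j : ℂ) * aeval z (nodalPoly S.gSeq S.xSeq j) * (truncSq (ξ - S.xSeq j) : ℂ)

theorem solution_eq (z : ℂ) {k : ℕ} (hk : k ≤ n) {ξ : ℝ} (h₁ : ∀ j < k, S.xSeq j ≤ ξ)
    (h₂ : ∀ j, k ≤ j → j < n → ξ ≤ S.xSeq j) :
    S.solution z ξ = aeval z (stringPoly S.gSeq S.xSeq k 0 ξ) := by
  rw [solution, aeval_stringPoly, S.sum_truncSq_eq hk h₁ h₂]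

theorem solution_xSeq (z : ℂ) {k : ℕ} (hk : k < n) :
    S.solution z (S.xSeq k) = aeval z (nodalPoly S.gSeq S.xSeq k) := by
  rw [nodalPoly_eq]
  exact S.solution_eq z hk.le (fun j hj => S.xSeq_le hj.le hk) fun j hj hj' => S.xSeq_le hj hj'

theorem continuous_solution (z : ℂ) : Continuous (S.solution z) := by
  refine Continuous.sub ?_ (continuous_const.mul (S.continuous_sum_truncSq _))
  simp only [halfSq_zero]
  fun_prop

theorem solvesEquation_solution (z : ℂ) : S.SolvesEquation z (S.solution z) := by
  refine ⟨(S.continuous_solution z).continuousOn, fun ψ h1 h2 h3 => ?_⟩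
  have h : IsTest ψ := ⟨h1, h2, h3⟩
  have hc : Continuous fun ξ => ((iteratedDeriv 3 ψ ξ : ℝ) : ℂ) :=
    Complex.continuous_ofReal.comp (h.iteratedDeriv 3).continuous
  have hq : ∫ ξ in (0 : ℝ)..1, ((halfSq 0 ξ : ℝ) : ℂ) * ((iteratedDeriv 3 ψ ξ : ℝ) : ℂ) = 0 := by
    have h4 := h.deriv.integral_pow_mul_iteratedDeriv 2
    rw [← iteratedDeriv_succ', intervalIntegral.integral_deriv_eq_sub
      (fun t _ => h.differentiable t) (h.deriv.continuous.intervalIntegrable _ _),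
      h.eq_zero (by simp), h.eq_zero (by simp), sub_zero, mul_zero] at h4
    simp_rw [← Complex.ofReal_mul, halfSq_zero, div_mul_eq_mul_div]
    rw [intervalIntegral.integral_ofReal, intervalIntegral.integral_div, h4]
    simp
  simp_rw [solution, sub_mul, mul_assoc z]
  rw [intervalIntegral.integral_sub, hq, intervalIntegral.integral_const_mul,
    S.integral_sum_truncSq_mul _ h, S.integral_mass, zero_sub, mul_neg, neg_neg]
  · congr 1
    refine Finset.sum_congr rfl fun j hj => ?_
    rw [← S.solution_xSeq z (Finset.mem_range.1 hj), solution]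
    ring
  · refine Continuous.intervalIntegrable (Continuous.mul ?_ hc) _ _
    simp only [halfSq_zero]
    fun_prop
  · exact (continuous_const.mul ((S.continuous_sum_truncSq _).mul hc)).intervalIntegrable _ _

variable {S} in
/-- A solution of the cubic string equation is a quadratic polynomial plus truncated powers. -/
theorem SolvesEquation.exists_eqOn {z : ℂ} {f : ℝ → ℂ} (h : S.SolvesEquation z f) :
    ∃ A B C : ℂ, EqOn f (fun ξ => A + B * ξ + C * (ξ : ℂ) ^ 2 / 2 - z * ∑ j ∈ Finset.range n,
      (S.gSeq j : ℂ) * f (S.xSeq j) * (truncSq (ξ - S.xSeq j) : ℂ)) (Icc 0 1) := by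
  have hK := S.continuous_sum_truncSq fun j => (S.gSeq j : ℂ) * f (S.xSeq j)
  obtain ⟨c, hc⟩ := eqOn_sum_pow_of_integral_mul_iteratedDeriv 3
    (f := fun ξ => f ξ + z * ∑ j ∈ Finset.range n,
      (S.gSeq j : ℂ) * f (S.xSeq j) * (truncSq (ξ - S.xSeq j) : ℂ))
    (h.1.add (continuous_const.mul hK).continuousOn) (by
      intro ψ hψ
      simp_rw [add_mul, mul_assoc z]
      rw [intervalIntegral.integral_add, h.2 ψ hψ.1 hψ.2 hψ.3, intervalIntegral.integral_const_mul,
        S.integral_sum_truncSq_mul _ hψ, S.integral_mass, mul_neg, add_neg_eq_zero]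
      · simp_rw [mul_assoc]
      · exact intervalIntegrable_mul_test h.1 (hψ.iteratedDeriv 3).continuous
      · exact (continuous_const.mul (hK.mul (Complex.continuous_ofReal.comp
          (hψ.iteratedDeriv 3).continuous))).intervalIntegrable _ _)
  refine ⟨c 0, c 1, 2 * c 2, fun ξ hξ => ?_⟩
  have := hc hξ
  simp only [Finset.sum_range_succ, Finset.sum_range_zero, pow_zero, pow_one, zero_add,
    mul_one] at this
  dsimp only
  linear_combination this

theorem eventually_le_xSeq : ∀ᶠ ξ in nhdsWithin (0 : ℝ) (Icc 0 1), ∀ j < n, ξ ≤ S.xSeq j := by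
  have : ∀ᶠ ξ in nhdsWithin (0 : ℝ) (Icc 0 1), ∀ j ∈ Finset.range n, ξ ≤ S.xSeq j := by
    rw [Filter.eventually_all_finset]
    exact fun j hj => nhdsWithin_le_nhds (Iic_mem_nhds (S.xSeq_mem (Finset.mem_range.1 hj)).1)
  simpa using this

theorem eventually_xSeq_le : ∀ᶠ ξ in nhdsWithin (1 : ℝ) (Icc 0 1), ∀ j < n, S.xSeq j ≤ ξ := by
  have : ∀ᶠ ξ in nhdsWithin (1 : ℝ) (Icc 0 1), ∀ j ∈ Finset.range n, S.xSeq j ≤ ξ := by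
    rw [Filter.eventually_all_finset]
    exact fun j hj => nhdsWithin_le_nhds (Ici_mem_nhds (S.xSeq_mem (Finset.mem_range.1 hj)).2)
  simpa using this

variable {S} in
theorem SolvesEquation.eqOn {z : ℂ} {f : ℝ → ℂ} (h : S.SolvesEquation z f)
    (h₀ : stringDeriv 0 f 0 = 0) (h₁ : stringDeriv 1 f 0 = 0) :
    EqOn f (fun ξ => stringDeriv 2 f 0 * S.solution z ξ) (Icc 0 1) := by
  obtain ⟨A, B, C, hf⟩ := h.exists_eqOn
  have hev : f =ᶠ[nhdsWithin (0 : ℝ) (Icc 0 1)]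
      fun ξ => A + B * ((ξ - 0 : ℝ) : ℂ) + C * ((ξ - 0 : ℝ) : ℂ) ^ 2 / 2 := by
    filter_upwards [S.eventually_le_xSeq, self_mem_nhdsWithin] with ξ hξ hξ'
    rw [hf hξ']
    dsimp only
    rw [S.sum_truncSq_eq n.zero_le (by simp) fun j _ hj => hξ j hj]
    simp
  obtain ⟨e0, e1, e2⟩ := stringDeriv_of_eventuallyEq (by simp) hev
  rw [h₀] at e0
  rw [h₁] at e1
  rw [e2]
  subst e0 e1
  have hnode : ∀ k < n, f (S.xSeq k) = C * aeval z (nodalPoly S.gSeq S.xSeq k) := by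
    intro k
    induction k using Nat.strong_induction_on with
    | _ k ih =>
      intro hk
      rw [hf (S.xSeq_mem_Icc hk), nodalPoly_eq, aeval_stringPoly]
      dsimp only
      rw [S.sum_truncSq_eq hk.le (fun j hj => S.xSeq_le hj.le hk) fun j hj hj' => S.xSeq_le hj hj',
        Finset.sum_congr rfl fun j hj => by
          rw [ih j (Finset.mem_range.1 hj) ((Finset.mem_range.1 hj).trans hk), mul_left_comm,
            mul_assoc C],
        ← Finset.mul_sum, halfSq_zero]
      push_cast
      ring
  intro ξ hξ
  rw [hf hξ]
  dsimp only
  rw [solution, Finset.sum_congr rfl fun j hj => by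
    rw [hnode j (Finset.mem_range.1 hj), mul_left_comm, mul_assoc C], ← Finset.mul_sum,
    halfSq_zero]
  push_cast
  ring

/-- The characteristic function of the boundary value problem of type `a`. -/
noncomputable def charPoly (a : Fin 3) : ℝ[X] := stringPoly S.gSeq S.xSeq n a 1

theorem stringDeriv_one_of_eqOn {z c : ℂ} {f : ℝ → ℂ}
    (h : EqOn f (fun ξ => c * S.solution z ξ) (Icc 0 1)) (a : Fin 3) :
    stringDeriv a f 1 = c * aeval z (S.charPoly a) := by
  have hev : f =ᶠ[nhdsWithin (1 : ℝ) (Icc 0 1)]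
      fun ξ => c * aeval z (S.charPoly 0) + c * aeval z (S.charPoly 1) * ((ξ - 1 : ℝ) : ℂ) +
        c * aeval z (S.charPoly 2) * ((ξ - 1 : ℝ) : ℂ) ^ 2 / 2 := by
    filter_upwards [S.eventually_xSeq_le, self_mem_nhdsWithin] with ξ hξ hξ'
    rw [h hξ']
    dsimp only
    rw [S.solution_eq z le_rfl hξ fun j hj hj' => absurd hj' hj.not_gt,
      stringPoly_zero_shift n 1 ξ]
    simp [charPoly]
    ring
  obtain ⟨e0, e1, e2⟩ := stringDeriv_of_eventuallyEq (by simp) hev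
  fin_cases a
  exacts [e0, e1, e2]

theorem stringDeriv_solution_one (z : ℂ) (a : Fin 3) :
    stringDeriv a (S.solution z) 1 = aeval z (S.charPoly a) := by
  rw [S.stringDeriv_one_of_eqOn (c := 1) (fun ξ _ => (one_mul _).symm), one_mul]

theorem solvesIVP_solution (z : ℂ) : S.SolvesIVP z (S.solution z) := by
  refine ⟨S.solvesEquation_solution z, stringDeriv_of_eventuallyEq (by simp) ?_⟩
  filter_upwards [S.eventually_le_xSeq] with ξ hξ
  rw [solution, S.sum_truncSq_eq n.zero_le (by simp) fun j _ hj => hξ j hj]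
  simp

theorem solution_ne_zero (z : ℂ) : ∃ ξ ∈ Icc (0 : ℝ) 1, S.solution z ξ ≠ 0 := by
  by_contra! h
  have h1 := (S.solvesIVP_solution z).2.2.2
  have h2 : S.solution z =ᶠ[nhdsWithin (0 : ℝ) (Icc 0 1)]
      fun ξ => 0 + 0 * ((ξ - 0 : ℝ) : ℂ) + 0 * ((ξ - 0 : ℝ) : ℂ) ^ 2 / 2 := by
    filter_upwards [self_mem_nhdsWithin] with ξ hξ
    simpa using h ξ hξ
  rw [(stringDeriv_of_eventuallyEq (by simp) h2).2.2] at h1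
  exact zero_ne_one h1

theorem isEigenfunction_solution {a : Fin 3} {z : ℂ} (h : aeval z (S.charPoly a) = 0) :
    S.IsEigenfunction a z (S.solution z) :=
  ⟨S.solvesEquation_solution z, (S.solvesIVP_solution z).2.1, (S.solvesIVP_solution z).2.2.1,
    (S.stringDeriv_solution_one z a).trans h, S.solution_ne_zero z⟩

theorem mem_spectrum_iff (a : Fin 3) (z : ℂ) : z ∈ S.spectrum a ↔ aeval z (S.charPoly a) = 0 := by
  refine ⟨?_, fun h => ⟨_, S.isEigenfunction_solution h⟩⟩
  rintro ⟨f, hf, h0, h1, ha, ξ, hξ, hne⟩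
  have h2 := hf.eqOn h0 h1
  rw [S.stringDeriv_one_of_eqOn h2, mul_eq_zero] at ha
  refine ha.resolve_left fun h3 => hne ?_
  rw [h2 hξ, h3]
  exact zero_mul _

theorem linearIndependent_nodal {ζ : Fin n → ℂ} (hζ : Function.Injective ζ) :
    LinearIndependent ℂ fun j (i : Fin n) => S.solution (ζ j) (S.xSeq i) := by
  have hdeg : ∀ i : Fin n, ∃ η, HasRootSeq (nodalPoly S.gSeq S.xSeq i) i η := by
    intro i
    obtain ⟨η, hη⟩ := exists_interlaced_stringPoly (g := S.gSeq) (x := S.xSeq) i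
      (fun j hj => S.gSeq_pos (hj.trans i.2)) (fun j hj => (S.xSeq_mem (hj.trans i.2)).1)
      (fun j k hjk hk => S.xSeq_lt hjk (hk.trans i.2)) (S.xSeq_mem i.2).1
      (fun j hj => S.xSeq_lt hj i.2)
    exact ⟨η 0, by rw [nodalPoly_eq]; exact hη.roots 0⟩
  have h := linearIndependent_eval_of_natDegree_eq
    (p := fun i : Fin n => (nodalPoly S.gSeq S.xSeq i).map (algebraMap ℝ ℂ))
    (fun i => by
      rw [Polynomial.map_ne_zero_iff (algebraMap ℝ ℂ).injective]
      intro h0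
      obtain ⟨η, hη⟩ := hdeg i
      simpa [h0] using hη.coeff_pos)
    (fun i => by
      obtain ⟨η, hη⟩ := hdeg i
      rw [natDegree_map, hη.natDegree_eq]) hζ
  simp_rw [eval_map_algebraMap, ← S.solution_xSeq _ (Fin.is_lt _)] at h
  exact h

theorem form_solution {z w : ℂ} (h : z + w ≠ 0) : S.form (S.solution z) (S.solution w) =
    (aeval z (S.charPoly 1) * aeval w (S.charPoly 1) -
      aeval z (S.charPoly 2) * aeval w (S.charPoly 0) -
      aeval z (S.charPoly 0) * aeval w (S.charPoly 2)) / (z + w) := by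
  rw [eq_div_iff h, mul_comm, form, S.integral_mass, charPoly, charPoly, charPoly,
    ← lagrange_identity]
  congr 1
  refine Finset.sum_congr rfl fun j hj => ?_
  rw [S.solution_xSeq _ (Finset.mem_range.1 hj), S.solution_xSeq _ (Finset.mem_range.1 hj)]

end DiscreteCubicString

theorem mainTheorem2 (n : ℕ) (S : DiscreteCubicString n) :
    -- the solution `φ z` of the initial value problem, unique on `[0,1]`
    ∃ φ : ℂ → ℝ → ℂ,
      (∀ z, S.SolvesIVP z (φ z)) ∧
      (∀ z f, S.SolvesIVP z f → EqOn f (φ z) (Icc 0 1)) ∧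
      -- the eigenvalues `ζ a j` of type `a`, in increasing order
      ∃ ζ : Fin 3 → Fin n → ℝ,
        (∀ a, StrictMono (ζ a)) ∧
        (∀ a, S.spectrum a = range (fun j => (ζ a j : ℂ))) ∧
        (∀ a j, 0 < ζ a j) ∧
        -- simplicity: `φ (ζ a j)` spans the eigenspace, and `ζ a j` is a simple zero of the
        -- characteristic function `z ↦ (d/dξ)ᵃ φ z (1)`
        (∀ a j, S.IsEigenfunction a (ζ a j) (φ (ζ a j))) ∧
        (∀ a j f, S.IsEigenfunction a (ζ a j) f →
          ∃ c : ℂ, EqOn f (fun ξ => c * φ (ζ a j) ξ) (Icc 0 1)) ∧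
        (∀ (a : Fin 3) j, deriv (fun z => stringDeriv (a : ℕ) (φ z) 1) (ζ a j) ≠ 0) ∧
        -- interlacing
        (∀ j, ζ 2 j < ζ 1 j ∧ ζ 1 j < ζ 0 j) ∧
        (∀ j k, j < k → ζ 0 j < ζ 2 k) ∧
        -- linear independence, as functions on `[0,1]` and modulo `g`-null sets
        (∀ a, LinearIndependent ℂ (fun j => (Icc (0 : ℝ) 1).domRestrict (φ (ζ a j)))) ∧
        (∀ a, LinearIndependent ℂ
          (fun j => (Filter.Germ.ofFun (φ (ζ a j)) : Filter.Germ (ae S.mass) ℂ))) ∧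
        -- factorization for the types 00, 01, 12 and 22
        (∀ i j, S.form (φ (ζ 0 i)) (φ (ζ 0 j)) =
          stringDeriv 1 (φ (ζ 0 i)) 1 * stringDeriv 1 (φ (ζ 0 j)) 1 / (ζ 0 i + ζ 0 j)) ∧
        (∀ i j, S.form (φ (ζ 0 i)) (φ (ζ 1 j)) =
          -(stringDeriv 2 (φ (ζ 0 i)) 1 * stringDeriv 0 (φ (ζ 1 j)) 1) / (ζ 0 i + ζ 1 j)) ∧
        (∀ i j, S.form (φ (ζ 1 i)) (φ (ζ 2 j)) =
          -(stringDeriv 2 (φ (ζ 1 i)) 1 * stringDeriv 0 (φ (ζ 2 j)) 1) / (ζ 1 i + ζ 2 j)) ∧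
        (∀ i j, S.form (φ (ζ 2 i)) (φ (ζ 2 j)) =
          stringDeriv 1 (φ (ζ 2 i)) 1 * stringDeriv 1 (φ (ζ 2 j)) 1 / (ζ 2 i + ζ 2 j)) := by
  obtain ⟨η, hη⟩ := exists_interlaced_stringPoly (g := S.gSeq) (x := S.xSeq) n
    (fun j hj => S.gSeq_pos hj) (fun j hj => (S.xSeq_mem hj).1)
    (fun j k hjk hk => S.xSeq_lt hjk hk) one_pos (fun j hj => (S.xSeq_mem hj).2)
  have hroot : ∀ (a : Fin 3) (j : Fin n), Polynomial.aeval (η a j : ℂ) (S.charPoly a) = 0 :=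
    fun a j => ((hη.roots a).aeval_eq_zero_iff _).2 ⟨j, j.2, rfl⟩
  have hmono : ∀ a, StrictMono fun j : Fin n => η a j := fun a j k hjk =>
    hη.strictMono a hjk k.2
  have hpos : ∀ a (j : Fin n), 0 < η a j := fun a j => hη.root_pos a j.2
  have hinj : ∀ a, Function.Injective fun j : Fin n => (η a j : ℂ) := fun a =>
    Complex.ofReal_injective.comp (hmono a).injective
  have hsum : ∀ a b (i j : Fin n), (η a i : ℂ) + η b j ≠ 0 := fun a b i j => by
    exact_mod_cast (add_pos (hpos a i) (hpos b j)).ne'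
  have hd : ∀ z (a : Fin 3), stringDeriv (a : ℕ) (S.solution z) 1 =
    Polynomial.aeval z (S.charPoly a) := S.stringDeriv_solution_one
  refine ⟨S.solution, S.solvesIVP_solution, fun z f hf => ?_, fun a j => η a j, hmono, fun a => ?_,
    hpos, fun a j => S.isEigenfunction_solution (hroot a j), fun a j f hf =>
      ⟨_, hf.1.eqOn hf.2.1 hf.2.2.1⟩, fun a j => ?_, fun j => ⟨hη.lt₂₁ j j.2, hη.lt₁₀ j j.2⟩,
    fun j k hjk => hη.lt₀₂ j k hjk k.2, fun a => ?_, fun a => ?_, fun i j => ?_, fun i j => ?_,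
    fun i j => ?_, fun i j => ?_⟩
  · have := hf.1.eqOn hf.2.1 hf.2.2.1
    simpa only [hf.2.2.2, one_mul] using this
  · ext z
    rw [S.mem_spectrum_iff, DiscreteCubicString.charPoly, (hη.roots a).aeval_eq_zero_iff]
    constructor
    · rintro ⟨j, hj, rfl⟩
      exact ⟨⟨j, hj⟩, rfl⟩
    · rintro ⟨j, rfl⟩
      exact ⟨j, j.2, rfl⟩
  · simp_rw [hd]
    rw [Polynomial.deriv_aeval]
    have h := (hη.roots a).eval_derivative_ne_zero j.2 fun i hi hij => by
      have := (hmono a).injective.ne (a₁ := ⟨i, hi⟩) (a₂ := j) fun h => hij (congrArg Fin.val h)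
      exact this
    have h' := Polynomial.aeval_algebraMap_apply_eq_algebraMap_eval (A := ℂ) (η a j)
      (Polynomial.derivative (S.charPoly a))
    rw [Complex.coe_algebraMap] at h'
    rw [h']
    exact_mod_cast h
  · have h := Fintype.linearIndependent_iff.1 (S.linearIndependent_nodal (hinj a))
    refine Fintype.linearIndependent_iff.2 fun c hc => h c ?_
    ext i
    have := congrFun hc ⟨S.xSeq i, S.xSeq_mem_Icc i.2⟩
    simp only [Finset.sum_apply, Pi.smul_apply] at this ⊢
    exact this
  · have h := Fintype.linearIndependent_iff.1 (S.linearIndependent_nodal (hinj a))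
    refine Fintype.linearIndependent_iff.2 fun c hc => h c ?_
    have hc' : Filter.Germ.ofFun (l := ae S.mass) (∑ j : Fin n, c j • S.solution (η a j)) =
        Filter.Germ.ofFun (0 : ℝ → ℂ) :=
      (map_sum (Filter.Germ.coeAddHom (M := ℂ) (ae S.mass)) _ _).trans hc
    have hae := Filter.Germ.coe_eq.1 hc'
    ext i
    simpa only [Finset.sum_apply, Pi.smul_apply, Pi.zero_apply] using S.of_ae_mass hae i.2
  · rw [S.form_solution (hsum 0 0 i j), hroot 0 i, hroot 0 j, ← hd _ 1, ← hd _ 1]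
    simp
  · rw [S.form_solution (hsum 0 1 i j), hroot 0 i, hroot 1 j, ← hd _ 2, ← hd _ 0]
    simp
  · rw [S.form_solution (hsum 1 2 i j), hroot 1 i, hroot 2 j, ← hd _ 2, ← hd _ 0]
    simp
  · rw [S.form_solution (hsum 2 2 i j), hroot 2 i, hroot 2 j, ← hd _ 1, ← hd _ 1]
    simp
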